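/- Let $p,q$ be probability distributions on a finite set $\mathcal X$. A (randomised) test with $n$ samples maps each dataset in $\mathcal X^n$ to a random output in $\{0,1\}$ ($0$ = decide $p$, $1$ = decide $q$). *Privacy.* A test $\phi$ is $\gamma$-DP if $\Pr[\phi(S)\in E]\le e^{\gamma}\Pr[\phi(S')\in E]$ for all $E\subseteq\{0,1\}$ and all $S,S'\in\mathcal X^n$ differing in at most one entry. Let $e_n(\phi)=\Pr_{p^{\otimes n}}[\phi=1]+\Pr_{q^{\otimes n}}[\phi=0]$, and let $n^\star_{\mathrm{privacy}}(\gamma)=\min\{n:\inf_{\phi\ \gamma\text{-DP}}e_n(\phi)\le 1/10\}$, $\gamma^\star(n)=\inf\{\gamma>0: n^\star_{\mathrm{privacy}}(\gamma)\le n\}$ and $$N_{\mathrm{Transformation}}(\eta)=\min\{n\ge 1: n\,\gamma^\star(n)\le 1/\eta\},$$ where the minimum or infimum of the empty set is $\infty$. *Robustness.* An $\eta$-adaptive-TV (strong contamination) adversary sees the dataset of $n$ i.i.d. samples and replaces $\lfloor n\eta\rfloor$ of them, of its choice, by arbitrary elements of $\mathcal X$; the result is uniformly permuted and given to the test. The robust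 error of a test is the sum of its worst-case type-I and worst-case type-II errors over all such adversaries, and $n^\star_{\mathrm{robust}}(\eta)$ is the least $n$ for which the infimum of the robust error over tests with $n$ samples is at most $1/10$ ($\infty$ if there is none). There are universal constants $0<C_2<C_1$, $C_3>0$, $\varepsilon_0\in(0,1/2)$, which are transformation constants between private and robust tests in the sense that, for all $p,q$, 1. if some $\gamma$-DP test with $n$ samples ($\gamma>0$) has $e_n\le 1/10$, then some test with $O(n)$ samples has $\frac{C_2}{n\gamma}$-robust error at most $1/10$; 2. if some test with $n$ samples has $\varepsilon$-robust error at most $1/10$, where $0<\varepsilon<\varepsilon_0$, then some $\frac{C_1}{n\varepsilon}$-DP test with at most $C_3n$ samples has $e\le 1/10$; and there are universal constants $c>0$ and $K\in\mathbb N$, $K\geq 1$, such that for all finite $\mathcal X$, all $p,q$ on $\mathcal X$ and all $0<\eta\le c\,d_{\mathrm{TV}}(p,q)$, $$N_{\mathrm{Transformation}}\Big(\frac{\eta}{C_1C_3}\Big)\le K\,n^\star_{\mathrm{robust}}(\eta)\qquad\text{and}\qquad n^\star_{\mathrm{robust}}(\eta)\le K\,N_{\mathrm{Transformation}}\Big(\frac{\eta}{C_2}\Big).$$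 -/

import Mathlib

universe u

namespace RobustTesting

noncomputable section

open scoped ENNReal

/-- A randomised algorithm using `n` samples from `X` with outputs in the finite set `Y`:
each dataset is mapped to the law of the output. -/
abbrev RandAlg (n : ℕ) (X : Type u) (Y : Type) [Fintype Y] : Type u :=
  (Fin n → X) → stdSimplex ℝ Y

/-- A randomised test: output `0` decides for `p`, output `1` decides for `q`. -/
abbrev RandTest (n : ℕ) (X : Type u) : Type u := RandAlg n X (Fin 2)

/-- The expectation of `f (X₁, …, Xₙ)` for i.i.d. samples `Xᵢ` drawn from `p`. -/
def iidExp {X : Type u} [Fintype X] {n : ℕ} (p : stdSimplex ℝ X) (f : (Fin n → X) → ℝ) : ℝ :=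
  ∑ x : Fin n → X, (∏ i, p (x i)) * f x

/-- Total variation distance. -/
def dTV {X : Type u} [Fintype X] (p q : stdSimplex ℝ X) : ℝ := (1 / 2) * ∑ x, |p x - q x|

/-- The sum of the type-I and type-II errors of a test on clean samples. -/
def testError {X : Type u} [Fintype X] {n : ℕ} (φ : RandTest n X) (p q : stdSimplex ℝ X) : ℝ :=
  iidExp p (fun x => φ x 1) + iidExp q (fun x => φ x 0)

/-- `γ`-differential privacy: for all events `E` and all datasets `S`, `S'` that differ in at most
one observation, `P(A(S) ∈ E) ≤ exp γ * P(A(S') ∈ E)`. -/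
def IsDP {X : Type u} [DecidableEq X] {n : ℕ} {Y : Type} [Fintype Y]
    (γ : ℝ) (A : RandAlg n X Y) : Prop :=
  ∀ S S' : Fin n → X, hammingDist S S' ≤ 1 →
    ∀ E : Finset Y, ∑ y ∈ E, A S y ≤ Real.exp γ * ∑ y ∈ E, A S' y

/-- The optimal error of a `γ`-DP test between `p` and `q` with `n` samples. -/
def privateError {X : Type u} [Fintype X] [DecidableEq X] (p q : stdSimplex ℝ X)
    (n : ℕ) (γ : ℝ) : ℝ :=
  ⨅ φ : {φ : RandTest n X // IsDP γ φ}, testError φ.1 p q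

/-- The private sample complexity, `⊤` if no number of samples suffices. -/
def nPrivacy {X : Type u} [Fintype X] [DecidableEq X] (p q : stdSimplex ℝ X) (γ : ℝ) : ℕ∞ :=
  ⨅ (n : ℕ) (_ : privateError p q n γ ≤ 1 / 10), (n : ℕ∞)

/-- The best privacy level `γ > 0` achievable with `n` samples, `⊤` if there is none. -/
def gammaStar {X : Type u} [Fintype X] [DecidableEq X] (p q : stdSimplex ℝ X) (n : ℕ) : ℝ≥0∞ :=
  ⨅ (γ : ℝ) (_ : 0 < γ ∧ nPrivacy p q γ ≤ n), ENNReal.ofReal γ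

/-- The least `n ≥ 1` such that `n * γ*(n) ≤ 1 / η`, and `⊤` if there is none. -/
def nTransformation {X : Type u} [Fintype X] [DecidableEq X] (p q : stdSimplex ℝ X)
    (η : ℝ) : ℕ∞ :=
  ⨅ (n : ℕ) (_ : 1 ≤ n ∧ (n : ℝ≥0∞) * gammaStar p q n ≤ ENNReal.ofReal (1 / η)), (n : ℕ∞)

/-- An adaptive-TV adversary: it sees the whole dataset and replaces `⌊n ε⌋` samples of its choice
by samples of its choice (a sample may be replaced by itself). -/
def Adversary (n : ℕ) (X : Type u) [DecidableEq X] (ε : ℝ) : Type u :=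
  {a : (Fin n → X) → (Fin n → X) // ∀ S, hammingDist S (a S) ≤ ⌊(n : ℝ) * ε⌋₊}

/-- The probability that `φ` outputs `b` on the corrupted dataset, when clean samples are drawn
i.i.d. from `p`, corrupted by the adversary `a`, and then uniformly permuted. -/
def corruptedProb {X : Type u} [Fintype X] [DecidableEq X] {n : ℕ} {ε : ℝ} (φ : RandTest n X)
    (p : stdSimplex ℝ X) (a : Adversary n X ε) (b : Fin 2) : ℝ :=
  iidExp p (fun S =>
    (1 / (n.factorial : ℝ)) * ∑ σ : Equiv.Perm (Fin n), φ (fun i => a.1 S (σ i)) b)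

/-- The sum of the worst-case type-I and the worst-case type-II error of a test under adaptive-TV
(strong) contamination. -/
def robustTestError {X : Type u} [Fintype X] [DecidableEq X] {n : ℕ} (ε : ℝ) (φ : RandTest n X)
    (p q : stdSimplex ℝ X) : ℝ :=
  (⨆ a : Adversary n X ε, corruptedProb φ p a 1) + ⨆ a : Adversary n X ε, corruptedProb φ q a 0

/-- The optimal error of a test with `n` samples under adaptive-TV contamination. -/
def robustError {X : Type u} [Fintype X] [DecidableEq X] (p q : stdSimplex ℝ X)
    (n : ℕ) (ε : ℝ) : ℝ :=
  ⨅ φ : RandTest n X, robustTestError ε φ p q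

/-- The sample complexity under adaptive-TV contamination, `⊤` if no number of samples suffices. -/
def nRobust {X : Type u} [Fintype X] [DecidableEq X] (p q : stdSimplex ℝ X) (ε : ℝ) : ℕ∞ :=
  ⨅ (n : ℕ) (_ : robustError p q n ε ≤ 1 / 10), (n : ℕ∞)

/-- `C₂` is a valid constant for passing from private to robust tests: for some constant `C`, from
every `γ`-DP test with `n` samples one gets a `C₂ / (n γ)`-robust test with at most `C n`
samples. -/
def PrivateToRobust (C₂ : ℝ) : Prop :=
  ∃ C : ℝ, 0 < C ∧
    ∀ (X : Type u) [Fintype X] [DecidableEq X] (p q : stdSimplex ℝ X) (n : ℕ) (γ : ℝ), 0 < γ →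
      (∃ φ : RandTest n X, IsDP γ φ ∧ testError φ p q ≤ 1 / 10) →
      ∃ m : ℕ, (m : ℝ) ≤ C * n ∧
        ∃ ψ : RandTest m X, robustTestError (C₂ / (n * γ)) ψ p q ≤ 1 / 10

/-- `C₁`, `C₃` are valid constants for passing from robust to private tests: from every `ε`-robust
test with `n` samples, `0 < ε < ε₀`, one gets a `C₁ / (n ε)`-DP test with at most `C₃ n`
samples. -/
def RobustToPrivate (C₁ C₃ ε₀ : ℝ) : Prop :=
  ∀ (X : Type u) [Fintype X] [DecidableEq X] (p q : stdSimplex ℝ X) (n : ℕ) (ε : ℝ),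
    0 < ε → ε < ε₀ →
    (∃ φ : RandTest n X, robustTestError ε φ p q ≤ 1 / 10) →
    ∃ m : ℕ, (m : ℝ) ≤ C₃ * n ∧
      ∃ ψ : RandTest m X, IsDP (C₁ / (n * ε)) ψ ∧ testError ψ p q ≤ 1 / 10

end

end RobustTesting

/-! Private to robust: an adversary moves the dataset by Hamming distance at most `nε`, so group
privacy bounds the robust error by `exp (γnε)` times the clean error (`IsDP.robustTestError_le`).
Robust to private: replace each output probability by its least `γ`-log-Lipschitz majorant and
normalise. Datasets within reach of the adversary contribute at most the robust error; the others
contribute at most `exp (-γnε)` (`exists_isDP_testError_le`). Both steps inflate the error. A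
majority vote over three disjoint blocks repairs this: it turns error `e` into at most `3e²` and
keeps the privacy level, since neighbouring datasets differ in one block only. This accounts for the
factor 3 in sample sizes. Both conversions start from error `11/100` rather than `1/10`, so
near-minimisers of the optimal errors suffice. The sandwich then follows by unfolding the infima. -/

namespace RobustTesting

variable {X : Type u}

section Simplex

variable {n : ℕ}

lemma RandTest.nonneg (φ : RandTest n X) (S : Fin n → X) (y : Fin 2) : 0 ≤ φ S y :=
  (φ S).2.1 y

lemma RandTest.add_eq_one (φ : RandTest n X) (S : Fin n → X) : φ S 0 + φ S 1 = 1 := by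
  have h := (φ S).2.2
  rw [Fin.sum_univ_two] at h
  exact h

lemma RandTest.le_one (φ : RandTest n X) (S : Fin n → X) (y : Fin 2) : φ S y ≤ 1 := by
  have h := φ.add_eq_one S
  have h0 := φ.nonneg S 0
  have h1 := φ.nonneg S 1
  fin_cases y
  · show φ S 0 ≤ 1
    linarith
  · show φ S 1 ≤ 1
    linarith

/-- The test that outputs `0` and `1` with the given probabilities. -/
def testOfProb (g₀ g₁ : (Fin n → X) → ℝ) (h₀ : ∀ S, 0 ≤ g₀ S) (h₁ : ∀ S, 0 ≤ g₁ S)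
    (h : ∀ S, g₀ S + g₁ S = 1) : RandTest n X := fun S =>
  ⟨![g₀ S, g₁ S], by
    constructor
    · intro y
      fin_cases y
      · exact h₀ S
      · exact h₁ S
    · rw [Fin.sum_univ_two]
      exact h S⟩

instance : Nonempty (RandTest n X) :=
  ⟨testOfProb (fun _ => 1) (fun _ => 0) (by simp) (by simp) (by simp)⟩

end Simplex

/-! ### Expectations under product measures. -/

section Expectation

variable [Fintype X] {n : ℕ} (p : stdSimplex ℝ X)

lemma iidExp_mono {f g : (Fin n → X) → ℝ} (h : ∀ x, f x ≤ g x) : iidExp p f ≤ iidExp p g :=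
  Finset.sum_le_sum fun x _ =>
    mul_le_mul_of_nonneg_left (h x) (Finset.prod_nonneg fun i _ => p.2.1 (x i))

lemma iidExp_add (f g : (Fin n → X) → ℝ) :
    iidExp p (fun x => f x + g x) = iidExp p f + iidExp p g := by
  simp only [iidExp, mul_add, Finset.sum_add_distrib]

lemma iidExp_sub (f g : (Fin n → X) → ℝ) :
    iidExp p (fun x => f x - g x) = iidExp p f - iidExp p g := by
  simp only [iidExp, mul_sub, Finset.sum_sub_distrib]

lemma iidExp_const_mul (c : ℝ) (f : (Fin n → X) → ℝ) :
    iidExp p (fun x => c * f x) = c * iidExp p f := by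
  simp only [iidExp, Finset.mul_sum]
  exact Finset.sum_congr rfl fun x _ => by ring

lemma iidExp_sum {ι : Type*} (s : Finset ι) (f : ι → (Fin n → X) → ℝ) :
    iidExp p (fun x => ∑ i ∈ s, f i x) = ∑ i ∈ s, iidExp p (f i) := by
  simp only [iidExp, Finset.mul_sum]
  exact Finset.sum_comm

lemma iidExp_one : iidExp (n := n) p (fun _ => 1) = 1 := by
  have h : ∑ x, p x = 1 := p.2.2
  have := Finset.prod_univ_sum (fun _ : Fin n => (Finset.univ : Finset X)) (fun _ x => p x)
  simp only [h, Finset.prod_const_one, Fintype.piFinset_univ] at this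
  simp only [iidExp, mul_one]
  exact this.symm

lemma iidExp_const (c : ℝ) : iidExp (n := n) p (fun _ => c) = c := by
  have := iidExp_const_mul (n := n) p c (fun _ => 1)
  simpa [iidExp_one] using this

lemma iidExp_nonneg {f : (Fin n → X) → ℝ} (h : ∀ x, 0 ≤ f x) : 0 ≤ iidExp p f := by
  simpa [iidExp_const] using iidExp_mono p (f := fun _ => 0) h

lemma iidExp_comp_perm (σ : Equiv.Perm (Fin n)) (f : (Fin n → X) → ℝ) :
    iidExp p (fun S => f (fun i => S (σ i))) = iidExp p f := by
  refine Fintype.sum_equiv (σ.symm.arrowCongr (Equiv.refl X)) _ _ fun S => ?_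
  have h : (σ.symm.arrowCongr (Equiv.refl X)) S = fun i => S (σ i) := by
    ext i
    simp [Equiv.arrowCongr]
  rw [h]
  simp only
  rw [Equiv.prod_comp σ (fun i => p (S i))]

/-- Functions of disjoint blocks of samples are independent. -/
lemma iidExp_append {m : ℕ} (f : (Fin m → X) → ℝ) (g : (Fin n → X) → ℝ) :
    iidExp p (fun S : Fin (m + n) → X =>
      f (fun i => S (Fin.castAdd n i)) * g (fun i => S (Fin.natAdd m i))) =
      iidExp p f * iidExp p g := by
  simp only [iidExp]
  rw [← Equiv.sum_comp (Fin.appendEquiv m n), Fintype.sum_prod_type, Finset.sum_mul_sum]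
  refine Finset.sum_congr rfl fun x _ => Finset.sum_congr rfl fun y _ => ?_
  simp only [Fin.appendEquiv, Equiv.coe_fn_mk, Fin.prod_univ_add, Fin.append_left,
    Fin.append_right]
  ring

end Expectation

/-! ### Differential privacy and group privacy. -/

section Privacy

variable [DecidableEq X] {n : ℕ}

lemma isDP_iff {γ : ℝ} {φ : RandTest n X} :
    IsDP γ φ ↔ ∀ S S', hammingDist S S' ≤ 1 → ∀ y, φ S y ≤ Real.exp γ * φ S' y := by
  constructor
  · intro h S S' hS y
    simpa using h S S' hS {y}
  · intro h S S' hS E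
    rw [Finset.mul_sum]
    exact Finset.sum_le_sum fun y _ => h S S' hS y

/-- Correcting a single differing coordinate gives the intermediate dataset; this drives the
induction for group privacy. -/
lemma exists_hammingDist_succ {S S' : Fin n → X} {d : ℕ} (h : hammingDist S S' ≤ d + 1) :
    ∃ T, hammingDist S T ≤ 1 ∧ hammingDist T S' ≤ d := by
  by_cases hS : S = S'
  · exact ⟨S, by simp, by simp [hS]⟩
  obtain ⟨i, hi⟩ := Function.ne_iff.1 hS
  refine ⟨Function.update S i (S' i), ?_, ?_⟩
  · refine (Finset.card_le_card (t := {i}) fun j hj => ?_).trans (by simp)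
    by_contra hji
    simp only [Finset.mem_singleton] at hji
    simp [Function.update_of_ne hji] at hj
  · have hlt : hammingDist (Function.update S i (S' i)) S' < hammingDist S S' := by
      refine Finset.card_lt_card (Finset.ssubset_iff_of_subset (fun j hj => ?_) |>.2 ⟨i, ?_, ?_⟩)
      · rcases eq_or_ne j i with rfl | hji
        · simp at hj
        · simpa [Function.update_of_ne hji] using hj
      · simpa using hi
      · simp
    omega

/-- Group privacy. -/
lemma IsDP.le_exp_mul {γ : ℝ} {φ : RandTest n X} (h : IsDP γ φ) (d : ℕ) {S S' : Fin n → X}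
    (hS : hammingDist S S' ≤ d) (y : Fin 2) : φ S y ≤ Real.exp (γ * d) * φ S' y := by
  induction d generalizing S with
  | zero =>
    have : S = S' := hammingDist_eq_zero.1 (Nat.le_zero.1 hS)
    simp [this]
  | succ d ih =>
    obtain ⟨T, h1, h2⟩ := exists_hammingDist_succ hS
    calc φ S y ≤ Real.exp γ * φ T y := isDP_iff.1 h S T h1 y
      _ ≤ Real.exp γ * (Real.exp (γ * d) * φ S' y) :=
        mul_le_mul_of_nonneg_left (ih h2) (Real.exp_pos _).le
      _ = Real.exp (γ * (d + 1 : ℕ)) * φ S' y := by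
        rw [← mul_assoc, ← Real.exp_add]
        push_cast
        ring_nf

lemma hammingDist_append {m : ℕ} (S S' : Fin (m + n) → X) :
    hammingDist S S' =
      hammingDist (fun i => S (Fin.castAdd n i)) (fun i => S' (Fin.castAdd n i)) +
        hammingDist (fun i => S (Fin.natAdd m i)) (fun i => S' (Fin.natAdd m i)) := by
  simp only [hammingDist, Finset.card_filter, Fin.sum_univ_add]

/-- A constant test is private. It makes the index type of `privateError` nonempty, so that a bound
on the real infimum yields an actual test. -/
lemma exists_isDP (X : Type u) [DecidableEq X] (n : ℕ) {γ : ℝ} (hγ : 0 ≤ γ) :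
    ∃ φ : RandTest n X, IsDP γ φ := by
  refine ⟨testOfProb (fun _ => 1) (fun _ => 0) (by simp) (by simp) (by simp),
    isDP_iff.2 fun S S' _ y => ?_⟩
  have h := RandTest.nonneg
    (testOfProb (X := X) (n := n) (fun _ => 1) (fun _ => 0) (by simp) (by simp) (by simp)) S y
  exact le_mul_of_one_le_left h (Real.one_le_exp hγ)

end Privacy

section Padding

variable {n : ℕ}

/-- The test that ignores the last `k` samples. -/
def RandTest.pad (φ : RandTest n X) (k : ℕ) : RandTest (n + k) X :=
  fun S => φ fun i => S (Fin.castAdd k i)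

lemma RandTest.isDP_pad [DecidableEq X] {φ : RandTest n X} {γ : ℝ} (h : IsDP γ φ) (k : ℕ) :
    IsDP γ (φ.pad k) := by
  intro S S' hS
  refine h _ _ ?_
  rw [hammingDist_append] at hS
  omega

lemma RandTest.testError_pad [Fintype X] (φ : RandTest n X) (k : ℕ) (p q : stdSimplex ℝ X) :
    testError (φ.pad k) p q = testError φ p q := by
  have key : ∀ (r : stdSimplex ℝ X) (y : Fin 2),
      iidExp r (fun x => φ.pad k x y) = iidExp r (fun x => φ x y) := by
    intro r y
    have := iidExp_append r (fun x => φ x y) (fun _ : Fin k → X => (1 : ℝ))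
    simpa [iidExp_one, RandTest.pad] using this
  simp only [testError, key]

end Padding

/-! ### Error amplification by a majority vote of three. -/

section Majority

/-- The probability that at least two of three independent events of probabilities `x`, `y`, `z`
occur. -/
def maj (x y z : ℝ) : ℝ := x * y + y * z + z * x - 2 * (x * y * z)

lemma maj_nonneg {x y z : ℝ} (hx : 0 ≤ x) (hy : 0 ≤ y) (hz : 0 ≤ z) (hx1 : x ≤ 1)
    (hz1 : z ≤ 1) : 0 ≤ maj x y z := by
  have h : maj x y z = x * y * (1 - z) + y * z * (1 - x) + z * x := by
    unfold maj
    ring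
  rw [h]
  have := sub_nonneg.2 hx1
  have := sub_nonneg.2 hz1
  positivity

lemma maj_rotate (x y z : ℝ) : maj x y z = maj y z x := by
  unfold maj
  ring

/-- In its first argument, `maj` is a combination of `x` and `1 - x` with nonnegative coefficients,
so multiplicative bounds on the probabilities of both outputs pass to the vote. -/
lemma maj_le_mul {x x' y z c : ℝ} (hy : 0 ≤ y) (hz : 0 ≤ z) (hy1 : y ≤ 1) (hz1 : z ≤ 1)
    (h : x ≤ c * x') (h' : 1 - x ≤ c * (1 - x')) : maj x y z ≤ c * maj x' y z := by
  have e : ∀ w, maj w y z = w * (y * (1 - z) + z * (1 - y) + y * z) + (1 - w) * (y * z) := by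
    intro w
    unfold maj
    ring
  have := sub_nonneg.2 hy1
  have := sub_nonneg.2 hz1
  have h1 : 0 ≤ y * (1 - z) + z * (1 - y) + y * z := by positivity
  have h2 : 0 ≤ y * z := by positivity
  rw [e, e]
  nlinarith [mul_le_mul_of_nonneg_right h h1, mul_le_mul_of_nonneg_right h' h2]

variable {n : ℕ}

/-- The first of three blocks of samples. -/
def block₁ (S : Fin (n + n + n) → X) : Fin n → X :=
  fun i => S (Fin.castAdd n (Fin.castAdd n i))

/-- The second of three blocks of samples. -/
def block₂ (S : Fin (n + n + n) → X) : Fin n → X :=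
  fun i => S (Fin.castAdd n (Fin.natAdd n i))

/-- The third of three blocks of samples. -/
def block₃ (S : Fin (n + n + n) → X) : Fin n → X := fun i => S (Fin.natAdd (n + n) i)

/-- The majority vote of three runs of a test on disjoint blocks of samples. -/
def RandTest.majority (φ : RandTest n X) : RandTest (n + n + n) X :=
  testOfProb (fun S => maj (φ (block₁ S) 0) (φ (block₂ S) 0) (φ (block₃ S) 0))
    (fun S => maj (φ (block₁ S) 1) (φ (block₂ S) 1) (φ (block₃ S) 1))
    (fun _ => maj_nonneg (φ.nonneg _ _) (φ.nonneg _ _) (φ.nonneg _ _) (φ.le_one _ _)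
      (φ.le_one _ _))
    (fun _ => maj_nonneg (φ.nonneg _ _) (φ.nonneg _ _) (φ.nonneg _ _) (φ.le_one _ _)
      (φ.le_one _ _))
    (fun S => by
      have h₁ := φ.add_eq_one (block₁ S)
      have h₂ := φ.add_eq_one (block₂ S)
      have h₃ := φ.add_eq_one (block₃ S)
      rw [eq_sub_of_add_eq h₁, eq_sub_of_add_eq h₂, eq_sub_of_add_eq h₃]
      unfold maj
      ring)

lemma RandTest.majority_apply (φ : RandTest n X) (S : Fin (n + n + n) → X) (y : Fin 2) :
    φ.majority S y = maj (φ (block₁ S) y) (φ (block₂ S) y) (φ (block₃ S) y) := by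
  fin_cases y <;> rfl

lemma RandTest.exists_one_sub (φ : RandTest n X) (y : Fin 2) :
    ∃ y' : Fin 2, ∀ S, 1 - φ S y = φ S y' := by
  fin_cases y
  · exact ⟨1, fun S => by have := φ.add_eq_one S; simp only [Fin.zero_eta]; linarith⟩
  · exact ⟨0, fun S => by have := φ.add_eq_one S; simp only [Fin.mk_one]; linarith⟩

/-- Neighbouring datasets differ in at most one block, so only one argument of `maj` changes and
three runs cost no more privacy than one. -/
lemma RandTest.isDP_majority [DecidableEq X] {φ : RandTest n X} {γ : ℝ} (h : IsDP γ φ) :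
    IsDP γ φ.majority := by
  refine isDP_iff.2 fun S S' hS y => ?_
  rw [isDP_iff] at h
  obtain ⟨y', hy'⟩ := φ.exists_one_sub y
  have hd : hammingDist S S' = hammingDist (block₁ S) (block₁ S') +
      hammingDist (block₂ S) (block₂ S') + hammingDist (block₃ S) (block₃ S') := by
    rw [hammingDist_append, hammingDist_append]
    rfl
  have step : ∀ (T T' : Fin n → X) (b c : ℝ), hammingDist T T' ≤ 1 → 0 ≤ b → 0 ≤ c → b ≤ 1 →
      c ≤ 1 → maj (φ T y) b c ≤ Real.exp γ * maj (φ T' y) b c := by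
    intro T T' b c hT hb hc hb1 hc1
    refine maj_le_mul hb hc hb1 hc1 (h T T' hT y) ?_
    rw [hy', hy']
    exact h T T' hT y'
  rw [φ.majority_apply, φ.majority_apply]
  by_cases h₁ : block₁ S = block₁ S'
  · by_cases h₂ : block₂ S = block₂ S'
    · rw [h₁, h₂, ← maj_rotate (φ (block₃ S) y), ← maj_rotate (φ (block₃ S') y)]
      exact step _ _ _ _ (by omega) (φ.nonneg _ _) (φ.nonneg _ _) (φ.le_one _ _) (φ.le_one _ _)
    · have h₂' := hammingDist_pos.2 h₂
      have h₃ : block₃ S = block₃ S' := hammingDist_eq_zero.1 (by omega)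
      rw [h₁, h₃, maj_rotate, maj_rotate (φ (block₁ S') y)]
      exact step _ _ _ _ (by omega) (φ.nonneg _ _) (φ.nonneg _ _) (φ.le_one _ _) (φ.le_one _ _)
  · have h₁' := hammingDist_pos.2 h₁
    have h₂ : block₂ S = block₂ S' := hammingDist_eq_zero.1 (by omega)
    have h₃ : block₃ S = block₃ S' := hammingDist_eq_zero.1 (by omega)
    rw [h₂, h₃]
    exact step _ _ _ _ (by omega) (φ.nonneg _ _) (φ.nonneg _ _) (φ.le_one _ _) (φ.le_one _ _)

lemma iidExp_blocks [Fintype X] (p : stdSimplex ℝ X) (f g h : (Fin n → X) → ℝ) :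
    iidExp p (fun S => f (block₁ S) * g (block₂ S) * h (block₃ S)) =
      iidExp p f * iidExp p g * iidExp p h := by
  rw [← iidExp_append, ← iidExp_append]
  rfl

lemma RandTest.iidExp_majority [Fintype X] (φ : RandTest n X) (p : stdSimplex ℝ X) (y : Fin 2) :
    iidExp p (fun S => φ.majority S y) =
      3 * iidExp p (fun S => φ S y) ^ 2 - 2 * iidExp p (fun S => φ S y) ^ 3 := by
  have h := iidExp_blocks (n := n) p
  have h₁ := h (fun S => φ S y) (fun S => φ S y) (fun _ => 1)
  have h₂ := h (fun _ => 1) (fun S => φ S y) (fun S => φ S y)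
  have h₃ := h (fun S => φ S y) (fun _ => 1) (fun S => φ S y)
  have h₄ := h (fun S => φ S y) (fun S => φ S y) (fun S => φ S y)
  simp only [mul_one, one_mul, iidExp_one] at h₁ h₂ h₃
  simp only [φ.majority_apply, maj, mul_comm (φ (block₃ _) y) (φ (block₁ _) y)]
  rw [iidExp_sub, iidExp_add, iidExp_add, iidExp_const_mul, h₁, h₂, h₃, h₄]
  ring

lemma RandTest.testError_nonneg [Fintype X] (φ : RandTest n X) (p q : stdSimplex ℝ X) :
    0 ≤ testError φ p q :=
  add_nonneg (iidExp_nonneg p fun S => φ.nonneg S 1) (iidExp_nonneg q fun S => φ.nonneg S 0)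

/-- With type-I and type-II errors `a` and `b`, the vote has error `3a² - 2a³ + 3b² - 2b³ ≤ 3(a +
b)²`. -/
lemma RandTest.testError_majority_le [Fintype X] (φ : RandTest n X) (p q : stdSimplex ℝ X) :
    testError φ.majority p q ≤ 3 * testError φ p q ^ 2 := by
  simp only [testError, φ.iidExp_majority]
  have h₁ := iidExp_nonneg p fun S => φ.nonneg S 1
  have h₀ := iidExp_nonneg q fun S => φ.nonneg S 0
  nlinarith [mul_nonneg h₁ h₀, pow_nonneg h₁ 3, pow_nonneg h₀ 3]

end Majority

/-! ### Uniformly permuted datasets. -/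

section Symmetrization

variable {n : ℕ}

/-- The probability that a test outputs `y` on a uniformly permuted dataset. -/
noncomputable def symProb (φ : RandTest n X) (y : Fin 2) (S : Fin n → X) : ℝ :=
  (1 / (n.factorial : ℝ)) * ∑ σ : Equiv.Perm (Fin n), φ (fun i => S (σ i)) y

lemma symProb_nonneg (φ : RandTest n X) (y : Fin 2) (S : Fin n → X) : 0 ≤ symProb φ y S :=
  mul_nonneg (by positivity) (Finset.sum_nonneg fun _ _ => φ.nonneg _ _)

lemma symProb_add (φ : RandTest n X) (S : Fin n → X) : symProb φ 0 S + symProb φ 1 S = 1 := by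
  simp only [symProb]
  rw [← mul_add, ← Finset.sum_add_distrib]
  simp only [φ.add_eq_one, Finset.sum_const, Finset.card_univ, Fintype.card_perm,
    Fintype.card_fin, nsmul_eq_mul, mul_one]
  have : (n.factorial : ℝ) ≠ 0 := by positivity
  field_simp

lemma symProb_le_one (φ : RandTest n X) (y : Fin 2) (S : Fin n → X) : symProb φ y S ≤ 1 := by
  have h := symProb_add φ S
  have h₀ := symProb_nonneg φ 0 S
  have h₁ := symProb_nonneg φ 1 S
  fin_cases y
  · show symProb φ 0 S ≤ 1
    linarith
  · show symProb φ 1 S ≤ 1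
    linarith

/-- I.i.d. samples are exchangeable, so permuting clean data leaves the mean unchanged. -/
lemma iidExp_symProb [Fintype X] (φ : RandTest n X) (p : stdSimplex ℝ X) (y : Fin 2) :
    iidExp p (symProb φ y) = iidExp p fun S => φ S y := by
  unfold symProb
  rw [iidExp_const_mul, iidExp_sum]
  have (σ : Equiv.Perm (Fin n)) : iidExp p (fun S => φ (fun i => S (σ i)) y) =
      iidExp p fun S => φ S y := iidExp_comp_perm p σ fun S => φ S y
  simp only [this, Finset.sum_const, Finset.card_univ, Fintype.card_perm,
    Fintype.card_fin, nsmul_eq_mul]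
  have : (n.factorial : ℝ) ≠ 0 := by positivity
  field_simp

end Symmetrization

/-! ### Conversions between private and robust tests. -/

section Robustness

variable [Fintype X] [DecidableEq X] {n : ℕ} {ε : ℝ}

instance : Nonempty (Adversary n X ε) := ⟨⟨id, fun S => by simp⟩⟩

lemma bddAbove_corruptedProb (φ : RandTest n X) (p : stdSimplex ℝ X) (b : Fin 2) :
    BddAbove (Set.range fun a : Adversary n X ε => corruptedProb φ p a b) := by
  have : Finite (Adversary n X ε) := Subtype.finite
  exact (Set.finite_range _).bddAbove

/-- Private tests are robust, with a loss in the error. -/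
lemma IsDP.robustTestError_le {γ : ℝ} {φ : RandTest n X} (h : IsDP γ φ) (hγ : 0 ≤ γ)
    (hε : 0 ≤ ε) (p q : stdSimplex ℝ X) :
    robustTestError ε φ p q ≤ Real.exp (γ * (n * ε)) * testError φ p q := by
  have key (r : stdSimplex ℝ X) (y : Fin 2) : ⨆ a : Adversary n X ε, corruptedProb φ r a y ≤
      Real.exp (γ * (n * ε)) * iidExp r (fun S => φ S y) := by
    refine ciSup_le fun a => ?_
    rw [← iidExp_symProb, ← iidExp_const_mul]
    refine iidExp_mono r fun S => ?_
    change symProb φ y (a.1 S) ≤ _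
    unfold symProb
    rw [mul_left_comm (Real.exp _), Finset.mul_sum _ _ (Real.exp _)]
    refine mul_le_mul_of_nonneg_left (Finset.sum_le_sum fun σ _ => ?_) (by positivity)
    -- Permuting both datasets by the same `σ` preserves their distance.
    have hd : hammingDist (fun i => a.1 S (σ i)) (fun i => S (σ i)) ≤ ⌊(n : ℝ) * ε⌋₊ := by
      refine le_trans (le_of_eq ?_) (a.2 S)
      rw [hammingDist_comm]
      simp only [hammingDist, Finset.card_filter]
      exact Equiv.sum_comp σ (fun i => if S i ≠ a.1 S i then (1 : ℕ) else 0)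
    refine (h.le_exp_mul _ hd y).trans (mul_le_mul_of_nonneg_right ?_ (φ.nonneg _ _))
    exact Real.exp_le_exp.2 (mul_le_mul_of_nonneg_left (Nat.floor_le (a := (n : ℝ) * ε) (by positivity)) hγ)
  rw [robustTestError, testError, mul_add]
  exact add_le_add (key p 1) (key q 0)

/-- On the empty dataset the two error probabilities are those of complementary outputs. This
excludes `n = 0` for robust tests. -/
lemma robustTestError_zero (φ : RandTest 0 X) (p q : stdSimplex ℝ X) :
    1 ≤ robustTestError ε φ p q := by
  have key (r : stdSimplex ℝ X) (y : Fin 2) (S : Fin 0 → X) :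
      φ S y ≤ ⨆ a : Adversary 0 X ε, corruptedProb φ r a y := by
    refine le_trans (le_of_eq ?_) (le_ciSup (bddAbove_corruptedProb φ r y) (Classical.arbitrary _))
    simp [corruptedProb, iidExp, Subsingleton.elim _ S]
  have := φ.add_eq_one Fin.elim0
  have := key p 1 Fin.elim0
  have := key q 0 Fin.elim0
  rw [robustTestError]
  linarith

/-- The least majorant of `f` whose logarithm is `γ`-Lipschitz for the Hamming distance. -/
noncomputable def smooth (γ : ℝ) (f : (Fin n → X) → ℝ) (S : Fin n → X) : ℝ :=
  ⨆ T, f T * Real.exp (-(γ * hammingDist S T))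

lemma le_smooth_apply (γ : ℝ) (f : (Fin n → X) → ℝ) (S T : Fin n → X) :
    f T * Real.exp (-(γ * hammingDist S T)) ≤ smooth γ f S :=
  le_ciSup (f := fun T => f T * Real.exp (-(γ * hammingDist S T)))
    (Set.finite_range _).bddAbove T

lemma le_smooth (γ : ℝ) (f : (Fin n → X) → ℝ) (S : Fin n → X) : f S ≤ smooth γ f S := by
  simpa using le_smooth_apply γ f S S

/-- By the triangle inequality, each term of the supremum changes by a factor of at most `exp γ`. -/
lemma smooth_le_exp_mul {γ : ℝ} (hγ : 0 ≤ γ) {f : (Fin n → X) → ℝ} (hf : ∀ S, 0 ≤ f S)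
    {S S' : Fin n → X} (h : hammingDist S S' ≤ 1) :
    smooth γ f S ≤ Real.exp γ * smooth γ f S' := by
  have : Nonempty (Fin n → X) := ⟨S⟩
  refine ciSup_le fun T => ?_
  calc f T * Real.exp (-(γ * hammingDist S T))
      ≤ f T * (Real.exp γ * Real.exp (-(γ * hammingDist S' T))) := by
        refine mul_le_mul_of_nonneg_left ?_ (hf T)
        rw [← Real.exp_add, Real.exp_le_exp]
        have hd : (hammingDist S' T : ℝ) ≤ 1 + hammingDist S T := by
          have := hammingDist_triangle S' S T
          rw [hammingDist_comm S' S] at this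
          exact_mod_cast this.trans (by omega)
        nlinarith
    _ = Real.exp γ * (f T * Real.exp (-(γ * hammingDist S' T))) := by ring
    _ ≤ Real.exp γ * smooth γ f S' :=
        mul_le_mul_of_nonneg_left (le_smooth_apply γ f S' T) (Real.exp_pos _).le

/-- Split the supremum at the adversary's budget: inside the ball a best-responding adversary
dominates, outside it the exponential penalty does. -/
lemma iidExp_smooth_symProb_le {γ : ℝ} (hγ : 0 ≤ γ) (φ : RandTest n X) (p : stdSimplex ℝ X)
    (y : Fin 2) :
    iidExp p (smooth γ (symProb φ y)) ≤
      (⨆ a : Adversary n X ε, corruptedProb φ p a y) + Real.exp (-(γ * (n * ε))) := by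
  -- The worst dataset within budget, chosen for each `S`, defines the adversary.
  have hmax (S : Fin n → X) : ∃ T, hammingDist S T ≤ ⌊(n : ℝ) * ε⌋₊ ∧
      ∀ T', hammingDist S T' ≤ ⌊(n : ℝ) * ε⌋₊ → symProb φ y T' ≤ symProb φ y T := by
    obtain ⟨T, hT, h⟩ := Finset.exists_max_image
      (Finset.univ.filter fun T => hammingDist S T ≤ ⌊(n : ℝ) * ε⌋₊) (symProb φ y)
      ⟨S, by simp⟩
    exact ⟨T, by simpa using hT, fun T' hT' => h T' (by simpa using hT')⟩
  choose a ha hmax using hmax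
  refine le_trans ?_ (add_le_add_left
    (le_ciSup (bddAbove_corruptedProb φ p y) (⟨a, ha⟩ : Adversary n X ε)) _)
  rw [← iidExp_const (n := n) p (Real.exp (-(γ * (n * ε))))]
  refine le_trans (iidExp_mono p fun S => ?_) (iidExp_add p _ _).le
  have : Nonempty (Fin n → X) := ⟨S⟩
  refine ciSup_le fun T => ?_
  change _ ≤ symProb φ y (a S) + _
  by_cases hT : hammingDist S T ≤ ⌊(n : ℝ) * ε⌋₊
  · have h1 : Real.exp (-(γ * hammingDist S T)) ≤ 1 := by
      rw [Real.exp_le_one_iff]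
      have : 0 ≤ γ * hammingDist S T := by positivity
      linarith
    have h2 := mul_le_of_le_one_right (symProb_nonneg φ y T) h1
    linarith [hmax S T hT, Real.exp_pos (-(γ * (n * ε)))]
  · have h1 : (n : ℝ) * ε < hammingDist S T := (Nat.floor_lt' (by omega)).1 (not_le.1 hT)
    have h2 : Real.exp (-(γ * hammingDist S T)) ≤ Real.exp (-(γ * (n * ε))) :=
      Real.exp_le_exp.2 (neg_le_neg (mul_le_mul_of_nonneg_left h1.le hγ))
    have h3 := mul_le_of_le_one_left (Real.exp_pos (-(γ * hammingDist S T))).le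
      (symProb_le_one φ y T)
    linarith [symProb_nonneg φ y (a S)]

/-- Robust tests can be made private by the exponential mechanism. -/
lemma exists_isDP_testError_le {γ : ℝ} (hγ : 0 ≤ γ) (φ : RandTest n X) (p q : stdSimplex ℝ X) :
    ∃ ψ : RandTest n X, IsDP (2 * γ) ψ ∧
      testError ψ p q ≤ robustTestError ε φ p q + 2 * Real.exp (-(γ * (n * ε))) := by
  set u : Fin 2 → (Fin n → X) → ℝ := fun y => smooth γ (symProb φ y) with hu
  have hnn (y : Fin 2) (S : Fin n → X) : 0 ≤ u y S :=
    (symProb_nonneg φ y S).trans (le_smooth γ _ S)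
  have hone (S : Fin n → X) : 1 ≤ u 0 S + u 1 S := by
    rw [← symProb_add φ S]
    exact add_le_add (le_smooth γ _ S) (le_smooth γ _ S)
  have hpos (S : Fin n → X) : 0 < u 0 S + u 1 S := one_pos.trans_le (hone S)
  let ψ : RandTest n X := testOfProb (fun S => u 0 S / (u 0 S + u 1 S))
    (fun S => u 1 S / (u 0 S + u 1 S)) (fun S => div_nonneg (hnn 0 S) (hpos S).le)
    (fun S => div_nonneg (hnn 1 S) (hpos S).le)
    (fun S => by rw [← add_div, div_self (hpos S).ne'])
  have hψ (S : Fin n → X) (y : Fin 2) : ψ S y = u y S / (u 0 S + u 1 S) := by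
    fin_cases y <;> rfl
  have hle (S : Fin n → X) (y : Fin 2) : ψ S y ≤ u y S := by
    rw [hψ]
    exact div_le_self (hnn y S) (hone S)
  refine ⟨ψ, isDP_iff.2 fun S S' hS y => ?_, ?_⟩
  -- The numerator and the normaliser each cost a factor `exp γ`, hence `2 * γ`.
  · have h1 (y : Fin 2) : u y S ≤ Real.exp γ * u y S' :=
      smooth_le_exp_mul hγ (symProb_nonneg φ y) hS
    have h2 (y : Fin 2) : u y S' ≤ Real.exp γ * u y S :=
      smooth_le_exp_mul hγ (symProb_nonneg φ y) (by rwa [hammingDist_comm])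
    rw [hψ, hψ, ← mul_div_assoc, div_le_div_iff₀ (hpos S) (hpos S')]
    calc u y S * (u 0 S' + u 1 S')
        ≤ (Real.exp γ * u y S') * (Real.exp γ * (u 0 S + u 1 S)) := by
          refine mul_le_mul (h1 y) ?_ (hpos S').le (mul_nonneg (Real.exp_pos _).le (hnn y S'))
          rw [mul_add]
          exact add_le_add (h2 0) (h2 1)
      _ = Real.exp (2 * γ) * u y S' * (u 0 S + u 1 S) := by
          rw [two_mul, Real.exp_add]
          ring
  · have h₁ := (iidExp_mono p fun S => hle S 1).trans
      (iidExp_smooth_symProb_le (ε := ε) hγ φ p 1)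
    have h₀ := (iidExp_mono q fun S => hle S 0).trans
      (iidExp_smooth_symProb_le (ε := ε) hγ φ q 0)
    rw [testError, robustTestError]
    linarith

/-- Private tests of constant error yield robust tests. -/
lemma IsDP.robustTestError_majority_le {γ : ℝ} {φ : RandTest n X} (h : IsDP γ φ) (hγ : 0 ≤ γ)
    (hε : 0 ≤ ε) (hγε : γ * (n * ε) ≤ 1 / 4) {p q : stdSimplex ℝ X}
    (he : testError φ p q ≤ 11 / 100) : robustTestError ε φ.majority p q ≤ 1 / 10 := by
  have h1 := (RandTest.isDP_majority h).robustTestError_le hγ hε p q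
  have h2 := φ.testError_majority_le p q
  -- The vote uses `3n` samples, so the exponent is at most `3/4`; then `5/2 · 3 · 0.11² < 1/10`.
  have h3 : Real.exp (γ * ((n + n + n : ℕ) * ε)) ≤ 5 / 2 := by
    have h4 : γ * ((n + n + n : ℕ) * ε) ≤ 3 / 4 := by
      push_cast
      linarith
    have h5 : Real.exp (3 / 4) ≤ 5 / 2 := by
      have h6 : Real.exp (3 / 4) ^ 4 ≤ (5 / 2) ^ 4 := by
        rw [← Real.exp_nat_mul]
        have h7 : Real.exp (((4 : ℕ) : ℝ) * (3 / 4)) = Real.exp 1 ^ 3 := by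
          rw [← Real.exp_nat_mul]
          norm_num
        rw [h7]
        calc Real.exp 1 ^ 3 ≤ 2.7182818286 ^ 3 :=
              pow_le_pow_left₀ (Real.exp_pos _).le Real.exp_one_lt_d9.le 3
          _ ≤ (5 / 2) ^ 4 := by norm_num
      exact le_of_pow_le_pow_left₀ (by norm_num) (by norm_num) h6
    exact (Real.exp_le_exp.2 h4).trans h5
  have h0 := φ.testError_nonneg p q
  calc robustTestError ε φ.majority p q
      ≤ 5 / 2 * (3 * testError φ p q ^ 2) :=
        h1.trans (mul_le_mul h3 h2 (φ.majority.testError_nonneg p q) (by norm_num))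
    _ ≤ 5 / 2 * (3 * (11 / 100) ^ 2) := by gcongr
    _ ≤ 1 / 10 := by norm_num

/-- Robust tests of constant error yield private tests. -/
lemma exists_isDP_testError_le_of_robust {φ : RandTest n X} (hε : 0 < ε) {p q : stdSimplex ℝ X}
    (he : robustTestError ε φ p q ≤ 11 / 100) :
    ∃ ψ : RandTest (n + n + n) X, IsDP (10 / (n * ε)) ψ ∧ testError ψ p q ≤ 1 / 10 := by
  have hn : 0 < n := by
    rcases Nat.eq_zero_or_pos n with rfl | h
    · linarith [robustTestError_zero (ε := ε) φ p q]
    · exact h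
  have hnε : 0 < (n : ℝ) * ε := by positivity
  -- With `γ = 5/(nε)` the penalty is `exp (-5) ≤ 1/32`, so the error is at most `0.11 + 2/32 <
  -- 0.18`, and `3 · 0.18² < 1/10`.
  obtain ⟨ψ, hψ, hψe⟩ := exists_isDP_testError_le (ε := ε) (γ := 5 / (n * ε)) (by positivity) φ p q
  refine ⟨ψ.majority, RandTest.isDP_majority ?_, (ψ.testError_majority_le p q).trans ?_⟩
  · convert hψ using 1
    ring
  · rw [div_mul_cancel₀ _ hnε.ne'] at hψe
    have h5 : Real.exp (-5) ≤ 1 / 32 := by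
      rw [Real.exp_neg, ← one_div]
      refine one_div_le_one_div_of_le (by norm_num) ?_
      have h6 : Real.exp 5 = Real.exp 1 ^ 5 := by
        rw [← Real.exp_nat_mul]
        norm_num
      rw [h6]
      calc (32 : ℝ) = 2 ^ 5 := by norm_num
        _ ≤ Real.exp 1 ^ 5 := pow_le_pow_left₀ (by norm_num)
          (by linarith [Real.add_one_le_exp (1 : ℝ)]) 5
    have h0 := ψ.testError_nonneg p q
    have h7 : testError ψ p q ≤ 18 / 100 := by linarith
    calc 3 * testError ψ p q ^ 2 ≤ 3 * (18 / 100) ^ 2 := by gcongr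
      _ ≤ 1 / 10 := by norm_num

end Robustness

/-! ### Valid constants and sample complexities. -/

section SampleComplexity

lemma privateToRobust : PrivateToRobust.{u} (1 / 8) := by
  refine ⟨3, by norm_num, fun X _ _ p q n γ hγ ⟨φ, hφ, he⟩ =>
    ⟨n + n + n, by push_cast; linarith, φ.majority, ?_⟩⟩
  refine hφ.robustTestError_majority_le hγ.le (by positivity) ?_ (he.trans (by norm_num))
  rcases Nat.eq_zero_or_pos n with rfl | hn
  · simp
  · have : (n : ℝ) ≠ 0 := by positivity
    field_simp
    norm_num

lemma robustToPrivate (ε₀ : ℝ) : RobustToPrivate.{u} 10 3 ε₀ :=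
  fun X _ _ p q n ε hε _ ⟨φ, he⟩ => ⟨n + n + n, by push_cast; linarith,
    exists_isDP_testError_le_of_robust hε (he.trans (by norm_num))⟩

/-- An infimum at most `N` lies strictly below `N + 1`, so some term does too, and that term is an
integer. -/
lemma exists_le_of_iInf_le {P : ℕ → Prop} {N : ℕ} (h : (⨅ (n : ℕ) (_ : P n), (n : ℕ∞)) ≤ N) :
    ∃ n ≤ N, P n := by
  have h' : (⨅ (n : ℕ) (_ : P n), (n : ℕ∞)) < ((N + 1 : ℕ) : ℕ∞) :=
    h.trans_lt (by exact_mod_cast Nat.lt_succ_self N)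
  obtain ⟨n, hn⟩ := iInf_lt_iff.1 h'
  obtain ⟨hP, hn⟩ := iInf_lt_iff.1 hn
  exact ⟨n, Nat.lt_succ_iff.1 (by exact_mod_cast hn), hP⟩

variable [Fintype X] [DecidableEq X] {p q : stdSimplex ℝ X} {η : ℝ}

lemma bddBelow_testError (p q : stdSimplex ℝ X) (n : ℕ) (γ : ℝ) :
    BddBelow (Set.range fun φ : {φ : RandTest n X // IsDP γ φ} => testError φ.1 p q) :=
  ⟨0, by rintro _ ⟨φ, rfl⟩; exact φ.1.testError_nonneg p q⟩

lemma robustTestError_nonneg {n : ℕ} (φ : RandTest n X) (p q : stdSimplex ℝ X) :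
    0 ≤ robustTestError η φ p q :=
  add_nonneg
    (Real.iSup_nonneg fun a => iidExp_nonneg p fun S => symProb_nonneg φ 1 (a.1 S))
    (Real.iSup_nonneg fun a => iidExp_nonneg q fun S => symProb_nonneg φ 0 (a.1 S))

lemma nPrivacy_le {n : ℕ} {γ : ℝ} {φ : RandTest n X} (h : IsDP γ φ)
    (he : testError φ p q ≤ 1 / 10) : nPrivacy p q γ ≤ n :=
  iInf₂_le n ((ciInf_le (bddBelow_testError p q n γ) ⟨φ, h⟩).trans he)

lemma nRobust_le {n : ℕ} {φ : RandTest n X} (he : robustTestError η φ p q ≤ 1 / 10) :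
    nRobust p q η ≤ n :=
  have h : BddBelow (Set.range fun φ : RandTest n X => robustTestError η φ p q) :=
    ⟨0, by rintro _ ⟨φ, rfl⟩; exact robustTestError_nonneg φ p q⟩
  iInf₂_le n ((ciInf_le h φ).trans he)

lemma nTransformation_le_of_robustError (hη : 0 < η) {n : ℕ}
    (h : robustError p q n η ≤ 1 / 10) :
    nTransformation p q (η / (10 * 3)) ≤ ((n + n + n : ℕ) : ℕ∞) := by
  obtain ⟨φ, hφ⟩ := exists_lt_of_ciInf_lt (h.trans_lt (by norm_num : (1 / 10 : ℝ) < 11 / 100))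
  have hn : 0 < n := by
    rcases Nat.eq_zero_or_pos n with rfl | hn
    · linarith [robustTestError_zero (ε := η) φ p q]
    · exact hn
  obtain ⟨ψ, hψ, hψe⟩ := exists_isDP_testError_le_of_robust hη hφ.le
  refine iInf₂_le _ ⟨by omega, ?_⟩
  -- The final product is `3n · 10/(nη) = 30/η`, which is exactly why `η` is divided by `C₁C₃ = 10 ·
  -- 3`.
  have hγ : gammaStar p q (n + n + n) ≤ ENNReal.ofReal (10 / (n * η)) :=
    iInf₂_le _ ⟨by positivity, nPrivacy_le hψ hψe⟩
  refine (mul_le_mul_right hγ _).trans (le_of_eq ?_)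
  rw [← ENNReal.ofReal_natCast, ← ENNReal.ofReal_mul (by positivity)]
  congr 1
  have : (n : ℝ) ≠ 0 := by positivity
  push_cast
  field_simp
  norm_num

lemma nRobust_le_of_gammaStar (hη : 0 < η) {n : ℕ} (hn : 1 ≤ n)
    (h : (n : ENNReal) * gammaStar p q n ≤ ENNReal.ofReal (1 / (η / (1 / 8)))) :
    nRobust p q η ≤ ((n + n + n : ℕ) : ℕ∞) := by
  have hn' : 0 < (n : ℝ) := by exact_mod_cast hn
  -- The hypothesis gives `nγ* ≤ 1/(8η)`. Doubling this bound makes the inequality strict, so some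
  -- admissible `γ` satisfies `γnη < 1/4` even if `γ*` is not attained.
  have hlt : gammaStar p q n < ENNReal.ofReal (1 / 4 / (n * η)) := by
    by_contra! hge
    refine absurd ((mul_le_mul_right hge (n : ENNReal)).trans h) (not_le.2 ?_)
    rw [← ENNReal.ofReal_natCast, ← ENNReal.ofReal_mul hn'.le,
      ENNReal.ofReal_lt_ofReal_iff (by positivity)]
    rw [div_div_eq_mul_div, one_mul, ← mul_div_assoc, mul_div_mul_left _ _ hn'.ne']
    gcongr
    norm_num
  obtain ⟨γ, hγ⟩ := iInf_lt_iff.1 hlt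
  obtain ⟨⟨hγ0, hγn⟩, hγ⟩ := iInf_lt_iff.1 hγ
  rw [ENNReal.ofReal_lt_ofReal_iff (by positivity), lt_div_iff₀ (by positivity)] at hγ
  obtain ⟨m, hm, he⟩ := exists_le_of_iInf_le hγn
  -- The private test may use only `m ≤ n` samples; ignoring `k = n - m` further ones brings it to
  -- size `n`.
  obtain ⟨k, rfl⟩ := Nat.exists_eq_add_of_le hm
  have : Nonempty {φ : RandTest m X // IsDP γ φ} :=
    let ⟨φ, hφ⟩ := exists_isDP X m hγ0.le
    ⟨⟨φ, hφ⟩⟩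
  obtain ⟨⟨φ, hφ⟩, hφe⟩ :=
    exists_lt_of_ciInf_lt (he.trans_lt (by norm_num : (1 / 10 : ℝ) < 11 / 100))
  refine nRobust_le ((RandTest.isDP_pad hφ k).robustTestError_majority_le hγ0.le hη.le hγ.le ?_)
  rw [φ.testError_pad]
  exact hφe.le

end SampleComplexity

end RobustTesting

/-- There are universal constants `C₁, C₂, C₃`, valid for the two transformations between private
and robust tests, such that for `η ≪ d_TV(p, q)` the robust sample complexity is sandwiched, up to
a universal factor `K`, between the transformation sample complexities at `η / (C₁ C₃)` and
`η / C₂`. -/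
theorem corollary8p1 :
    ∃ C₁ C₂ C₃ ε₀ : ℝ, 0 < C₂ ∧ C₂ < C₁ ∧ 0 < C₃ ∧ 0 < ε₀ ∧ ε₀ < 1 / 2 ∧
      RobustTesting.PrivateToRobust.{u} C₂ ∧
      RobustTesting.RobustToPrivate.{u} C₁ C₃ ε₀ ∧
      ∃ (c : ℝ) (K : ℕ), 0 < c ∧ 0 < K ∧
        ∀ (X : Type u) [Fintype X] [DecidableEq X] (p q : stdSimplex ℝ X) (η : ℝ),
          0 < η → η ≤ c * RobustTesting.dTV p q →
          RobustTesting.nTransformation p q (η / (C₁ * C₃)) ≤ K * RobustTesting.nRobust p q η ∧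
          RobustTesting.nRobust p q η ≤ K * RobustTesting.nTransformation p q (η / C₂) := by
  refine ⟨10, 1 / 8, 3, 1 / 4, by norm_num, by norm_num, by norm_num, by norm_num, by norm_num,
    RobustTesting.privateToRobust, RobustTesting.robustToPrivate _, 1, 3, one_pos, by norm_num,
    fun X _ _ p q η hη _ => ⟨?_, ?_⟩⟩
  · rcases eq_or_ne (RobustTesting.nRobust p q η) ⊤ with h | h
    · rw [h, ENat.mul_top (by norm_num)]
      exact le_top
    obtain ⟨N, hN⟩ := ENat.ne_top_iff_exists.1 h
    obtain ⟨n, hn, he⟩ := RobustTesting.exists_le_of_iInf_le hN.ge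
    rw [← hN]
    refine (RobustTesting.nTransformation_le_of_robustError hη he).trans ?_
    exact_mod_cast (by omega : n + n + n ≤ 3 * N)
  · rcases eq_or_ne (RobustTesting.nTransformation p q (η / (1 / 8))) ⊤ with h | h
    · rw [h, ENat.mul_top (by norm_num)]
      exact le_top
    obtain ⟨N, hN⟩ := ENat.ne_top_iff_exists.1 h
    obtain ⟨n, hn, hn1, he⟩ := RobustTesting.exists_le_of_iInf_le hN.ge
    rw [← hN]
    refine (RobustTesting.nRobust_le_of_gammaStar hη hn1 he).trans ?_
    exact_mod_cast (by omega : n + n + n ≤ 3 * N)
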